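/- For $x\in[0,\infty)$ let $x=\sum_{j\in\mathbb Z}x_j2^{-j-1}$, $x_j\in\{0,1\}$, be the dyadic expansion with $x_j\to0$ as $j\to\infty$ (the terminating one when there are two). Put $x\oplus y=\sum_{j\in\mathbb Z}|x_j-y_j|2^{-j-1}$ and $w(t,x)=(-1)^{\sum_{j\in\mathbb Z}t_jx_{-j-1}}$ for $t,x,y\ge0$. For integrable $f:[0,\infty)\to\mathbb C$ let $\widehat f(t)=\int_0^\infty f(x)w(t,x)\,dx$. For square integrable $g:[0,\infty)\to\mathbb C$ let $$V(g)=\frac{1}{\|g\|_{L_2[0,\infty)}^2}\,\inf_{y\ge0}\int_0^\infty (x\oplus y)^2|g(x)|^2\,dx\in[0,\infty],$$ with the convention $0/0=0$ (used only for $g=0$), and let $UC_d(f)=V(f)V(\widehat f)$ be the dyadic uncertainty constant of $f$. **Lemma.** Let $(a_k)_{k\ge0}$ be complex numbers such that the series $\sum_{k=0}^\infty a_kw(k,x)$ converges uniformly on $[0,1)$. Let $f(x)=\chi_{[0,1)}(x)\sum_{k=0}^\infty a_kw(k,x)$ and $f_n(x)=\chi_{[0,1)}(x)\sum_{k=0}^{2^n-1}a_kw(k,x)$,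 $n\ge0$. Suppose that $V(f)<+\infty$ and $V(\widehat f)<+\infty$. Then $$UC_d(f)=\lim_{n\to\infty}V(f_n)V(\widehat{f_n}),$$ and for every $n\ge0$ (again with $0/0=0$) $$V(f_n)=\frac{\displaystyle\min_{0\le k_0\le 2^n-1}\ \sum_{k=0}^{2^n-1}|c_{k\oplus k_0}|^2\,\frac{(k+1)^3-k^3}{3}\,2^{-2n}}{\displaystyle\sum_{k=0}^{2^n-1}|a_k|^2},\qquad V(\widehat{f_n})=\frac{\displaystyle\min_{0\le k_1\le 2^n-1}\ \sum_{k=0}^{2^n-1}|a_{k\oplus k_1}|^2\,\frac{(k+1)^3-k^3}{3}}{\displaystyle\sum_{k=0}^{2^n-1}|c_k|^2},$$ where $c=(c_k)_{k=0}^{2^n-1}$ is the fast Walsh transform of $(a_k)_{k=0}^{2^n-1}$, that is $c_m=2^{-n/2}\sum_{k=0}^{2^n-1}a_k\,w(m,k/2^n)$ for $0\le m\le 2^n-1$. -/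

import Mathlib

open Set Filter Topology MeasureTheory
open scoped ENNReal Matrix

namespace DyadicUC

noncomputable section

/-- The dyadic digit `x_j` of `x = ∑_{j ∈ ℤ} x_j 2^{-j-1} ∈ [0, ∞)`; taking the floor selects the
expansion that terminates in zeros when there are two. -/
def digit (x : ℝ) (j : ℤ) : ℕ := ⌊x * (2 : ℝ) ^ (j + 1)⌋₊ % 2

/-- The dyadic sum `x ⊕ y` of `x, y ∈ [0, ∞)`. -/
def dyadicAdd (x y : ℝ) : ℝ :=
  ∑' j : ℤ, |(digit x j : ℝ) - (digit y j : ℝ)| * (2 : ℝ) ^ (-j - 1)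

/-- The generalized Walsh function `w(t, x) = (-1) ^ (∑_{j ∈ ℤ} t_j x_{-j-1})` for
`t, x ∈ [0, ∞)`. Only finitely many terms of the sum are nonzero. -/
def walsh (t x : ℝ) : ℝ := (-1) ^ (∑ᶠ j : ℤ, digit t j * digit x (-j - 1))

/-- The Walsh-Fourier transform of an integrable `f : [0, ∞) → ℂ`
(values of `f` at negative reals are ignored). -/
def walshFourier (f : ℝ → ℂ) (t : ℝ) : ℂ := ∫ x in Ici (0 : ℝ), f x * (walsh t x : ℂ)

/-- `V(f)`: the infimum over `y ∈ [0, ∞)` of `∫ (x ⊕ y)² |f(x)|² dx`, divided by `‖f‖²`, as an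
extended nonnegative real, for `f` square integrable on `[0, ∞)`. -/
def V (f : ℝ → ℂ) : ℝ≥0∞ :=
  (⨅ y ∈ Ici (0 : ℝ), ∫⁻ x in Ici (0 : ℝ), ENNReal.ofReal (dyadicAdd x y ^ 2) * ‖f x‖ₑ ^ 2) /
    ∫⁻ x in Ici (0 : ℝ), ‖f x‖ₑ ^ 2

/-- The dyadic uncertainty constant of an integrable and square integrable `f : [0, ∞) → ℂ`. -/
def UCd (f : ℝ → ℂ) : ℝ≥0∞ := V f * V (walshFourier f)

/-- The partial sum `∑_{k < N} a_k w(k, x)` of a Walsh series. -/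
def walshSum (a : ℕ → ℂ) (N : ℕ) (x : ℝ) : ℂ := ∑ k ∈ Finset.range N, a k * (walsh k x : ℂ)

/-- The `2 ^ n`-term partial sum of a Walsh series, restricted to `[0, 1)`. -/
def dyadicPartialSum (a : ℕ → ℂ) (n : ℕ) : ℝ → ℂ := (Ico (0 : ℝ) 1).indicator (walshSum a (2 ^ n))

/-- The normalized Walsh matrix `2^{-n/2} (w(m, k / 2^n))_{k, m = 0, …, 2^n - 1}`. -/
def walshMatrix (n : ℕ) : Matrix (Fin (2 ^ n)) (Fin (2 ^ n)) ℂ :=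
  Matrix.of fun k m => (((2 : ℝ) ^ (-(n : ℝ) / 2) * walsh (m : ℕ) ((k : ℕ) / 2 ^ n) : ℝ) : ℂ)

/-- The fast Walsh-Fourier transform `c = a W` of a row vector `a` of length `2^n`. -/
def fastWalsh (n : ℕ) (a : Fin (2 ^ n) → ℂ) : Fin (2 ^ n) → ℂ := a ᵥ* walshMatrix n

end

end DyadicUC

/-!
The restrictions `f_n` of the partial sums to `[0, 1)` are constant on the dyadic intervals of length
`2 ^ (-n)` (`dyadicPartialSum_eq`), with values `2 ^ (n / 2) c_k` (`norm_sq_cellValue`), and their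
Walsh–Fourier transforms are the step functions `t ↦ a_⌊t⌋` cut off at `2 ^ n`
(`walshFourier_dyadicPartialSum`), by orthogonality of the Walsh functions. The map `x ↦ x ⊕ y`
carries dyadic intervals to dyadic intervals of the same length, with exclusive or acting on their
numbers, and preserves measure, so that `∫ (x ⊕ y)² dx` over an interval is `∫ u² du` over its image
(`cellMoment_eq`). This is shown by bisection: both integrals are additive under it, and the crude
bounds for them on cells of length `2 ^ (-n)` become exact in the limit. Hence `V` of a dyadic step
function is an infimum over the numbers `q` of dyadic intervals. If the function is supported in the
first `2 ^ N` intervals, then reducing `q` modulo `2 ^ N` does not increase the moment, and the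
infimum is the minimum over `q < 2 ^ N` (`V_step`). Together with Parseval's identity this gives the
two closed forms.

For the limit, `V(f_n) → V(f)` since `|f_n|²` tends to `|f|²` uniformly on `[0, 1)` and `y` may be
restricted to `[0, 1)`, where `x ⊕ y ≤ 1`. On the Fourier side `f̂(t) = a_⌊t⌋`
(`walshFourier_eq_coeff`), and the moments of the truncations of `(a_k)` about `q` increase to that of
`(a_k)`. If some `a_j` is nonzero, its contribution alone tends to infinity with `q`, so that only
finitely many `q` compete in the infimum, which therefore converges (`tendsto_iInf_stepMoment`). The
denominators converge to `‖f‖² = ∑ |a_k|²`, which is positive and finite. If all `a_k` vanish, both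
sides are zero.
-/

namespace DyadicUC

/-! ### Binary digits and the dyadic sum -/

lemma digit_neg (x : ℝ) (i : ℕ) : digit x (-(i + 1 : ℤ)) = ⌊x⌋₊ / 2 ^ i % 2 := by
  have h : x * (2 : ℝ) ^ (-(i + 1 : ℤ) + 1) = x / ((2 ^ i : ℕ) : ℝ) := by
    rw [show (-(i + 1 : ℤ) + 1) = -(i : ℤ) by ring, zpow_neg, zpow_natCast]
    push_cast
    rfl
  rw [digit, h, Nat.floor_div_natCast]

lemma digit_two_pow_mul (n : ℕ) (x : ℝ) (j : ℤ) : digit (2 ^ n * x) j = digit x (j + n) := by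
  rw [digit, digit, show j + (n : ℤ) + 1 = (j + 1) + n by ring,
    zpow_add₀ two_ne_zero (j + 1) n, zpow_natCast]
  congr 2
  ring_nf

lemma digit_le_one (x : ℝ) (j : ℤ) : digit x j ≤ 1 := by
  unfold digit
  omega

lemma abs_digit_sub_le_one (x y : ℝ) (j : ℤ) : |(digit x j : ℝ) - digit y j| ≤ 1 := by
  have hx : (digit x j : ℝ) ≤ 1 := by exact_mod_cast digit_le_one x j
  have hy : (digit y j : ℝ) ≤ 1 := by exact_mod_cast digit_le_one y j
  have hx' : (0 : ℝ) ≤ digit x j := by positivity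
  have hy' : (0 : ℝ) ≤ digit y j := by positivity
  rw [abs_le]
  constructor <;> linarith

lemma abs_bit_sub_bit (p q i : ℕ) :
    |((p / 2 ^ i % 2 : ℕ) : ℝ) - ((q / 2 ^ i % 2 : ℕ) : ℝ)| = (((p ^^^ q) / 2 ^ i % 2 : ℕ) : ℝ) := by
  rw [Nat.xor_div_two_pow, Nat.xor_mod_two_eq, Nat.add_mod]
  rcases Nat.mod_two_eq_zero_or_one (p / 2 ^ i) with h | h <;>
    rcases Nat.mod_two_eq_zero_or_one (q / 2 ^ i) with h' | h' <;> simp [h, h']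

lemma sum_range_bits (p n : ℕ) :
    ∑ i ∈ Finset.range n, p / 2 ^ i % 2 * 2 ^ i + p / 2 ^ n * 2 ^ n = p := by
  induction n with
  | zero => simp
  | succ n ih =>
    rw [Finset.sum_range_succ]
    have h : p / 2 ^ (n + 1) = p / 2 ^ n / 2 := by rw [pow_succ, Nat.div_div_eq_div_mul]
    have h2 := Nat.div_add_mod (p / 2 ^ n) 2
    have : p / 2 ^ n % 2 * 2 ^ n + p / 2 ^ (n + 1) * 2 ^ (n + 1) = p / 2 ^ n * 2 ^ n := by
      rw [h, pow_succ]
      nth_rewrite 3 [← h2]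
      ring
    omega

lemma hasSum_bits (p : ℕ) : HasSum (fun i : ℕ => ((p / 2 ^ i % 2 : ℕ) : ℝ) * 2 ^ i) p := by
  have h := sum_range_bits p p
  rw [Nat.div_eq_of_lt (Nat.lt_two_pow_self), zero_mul, add_zero] at h
  have hs : HasSum (fun i : ℕ => ((p / 2 ^ i % 2 : ℕ) : ℝ) * 2 ^ i)
      (∑ i ∈ Finset.range p, ((p / 2 ^ i % 2 : ℕ) : ℝ) * 2 ^ i) := by
    refine hasSum_sum_of_ne_finset_zero fun i hi => ?_
    rw [Finset.mem_range, not_lt] at hi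
    rw [Nat.div_eq_of_lt (Nat.lt_two_pow_self.trans_le (Nat.pow_le_pow_right two_pos hi))]
    simp
  convert hs
  exact_mod_cast h.symm

lemma hasSum_two_pow_neg : HasSum (fun j : ℕ => (2 : ℝ) ^ (-(j : ℤ) - 1)) 1 := by
  convert hasSum_geometric_two' 1 using 2 with j
  rw [show -(j : ℤ) - 1 = -((j + 1 : ℕ) : ℤ) by push_cast; ring, zpow_neg, zpow_natCast, pow_succ]
  field_simp

/-- The contribution of the digits to the right of the binary point to `x ⊕ y`. -/
noncomputable def dyadicAddFract (x y : ℝ) : ℝ :=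
  ∑' j : ℕ, |(digit x j : ℝ) - (digit y j : ℝ)| * (2 : ℝ) ^ (-(j : ℤ) - 1)

lemma summable_dyadicAddFract (x y : ℝ) :
    Summable fun j : ℕ => |(digit x j : ℝ) - (digit y j : ℝ)| * (2 : ℝ) ^ (-(j : ℤ) - 1) :=
  hasSum_two_pow_neg.summable.of_nonneg_of_le (fun _ => by positivity) fun j =>
    mul_le_of_le_one_left (by positivity) (abs_digit_sub_le_one x y j)

lemma dyadicAddFract_nonneg (x y : ℝ) : 0 ≤ dyadicAddFract x y :=
  tsum_nonneg fun _ => by positivity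

lemma dyadicAddFract_le_one (x y : ℝ) : dyadicAddFract x y ≤ 1 := by
  rw [← hasSum_two_pow_neg.tsum_eq]
  exact (summable_dyadicAddFract x y).tsum_le_tsum
    (fun j => mul_le_of_le_one_left (by positivity) (abs_digit_sub_le_one x y j))
    hasSum_two_pow_neg.summable

/-- The integer parts combine by bitwise exclusive or. -/
lemma dyadicAdd_eq (x y : ℝ) :
    dyadicAdd x y = ((⌊x⌋₊ ^^^ ⌊y⌋₊ : ℕ) : ℝ) + dyadicAddFract x y := by
  rw [add_comm]
  refine HasSum.tsum_eq (HasSum.of_nat_of_neg_add_one ?_ ?_)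
  · exact (summable_dyadicAddFract x y).hasSum
  · convert hasSum_bits (⌊x⌋₊ ^^^ ⌊y⌋₊) using 2 with i
    rw [digit_neg, digit_neg, abs_bit_sub_bit,
      show -(-((i : ℤ) + 1)) - 1 = (i : ℤ) by ring, zpow_natCast]

lemma dyadicAdd_two_pow_mul (n : ℕ) (x y : ℝ) :
    dyadicAdd (2 ^ n * x) (2 ^ n * y) = 2 ^ n * dyadicAdd x y := by
  unfold dyadicAdd
  rw [← tsum_mul_left, ← (Equiv.addRight (n : ℤ)).tsum_eq
    fun j => 2 ^ n * (|(digit x j : ℝ) - digit y j| * (2 : ℝ) ^ (-j - 1))]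
  refine tsum_congr fun j => ?_
  rw [digit_two_pow_mul, digit_two_pow_mul, Equiv.coe_addRight,
    show -(j + (n : ℤ)) - 1 = -j - 1 - (n : ℤ) by ring,
    zpow_sub₀ two_ne_zero (-j - 1) n, zpow_natCast]
  field_simp

lemma dyadicAdd_nonneg (x y : ℝ) : 0 ≤ dyadicAdd x y := tsum_nonneg fun _ => by positivity

/-- At resolution `2 ^ (-n)` the dyadic sum is exclusive or of the cell numbers. -/
lemma xor_floor_le_dyadicAdd (n : ℕ) (x y : ℝ) :
    ((⌊2 ^ n * x⌋₊ ^^^ ⌊2 ^ n * y⌋₊ : ℕ) : ℝ) / 2 ^ n ≤ dyadicAdd x y := by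
  rw [div_le_iff₀' (by positivity), ← dyadicAdd_two_pow_mul, dyadicAdd_eq]
  linarith [dyadicAddFract_nonneg (2 ^ n * x) (2 ^ n * y)]

lemma dyadicAdd_le_xor_floor (n : ℕ) (x y : ℝ) :
    dyadicAdd x y ≤ (((⌊2 ^ n * x⌋₊ ^^^ ⌊2 ^ n * y⌋₊ : ℕ) : ℝ) + 1) / 2 ^ n := by
  rw [le_div_iff₀' (by positivity), ← dyadicAdd_two_pow_mul, dyadicAdd_eq]
  linarith [dyadicAddFract_le_one (2 ^ n * x) (2 ^ n * y)]

lemma dyadicAdd_le_one {x y : ℝ} (hx : x ∈ Ico (0 : ℝ) 1) (hy : y ∈ Ico (0 : ℝ) 1) :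
    dyadicAdd x y ≤ 1 := by
  have := dyadicAdd_le_xor_floor 0 x y
  rw [pow_zero, one_mul, one_mul, (Nat.floor_eq_zero).2 hx.2, (Nat.floor_eq_zero).2 hy.2] at this
  simpa using this

/-- Dropping the integer part of `y` brings it closer to every point of `[0, 1)`. -/
lemma dyadicAdd_sub_floor_le {x y : ℝ} (hx : x ∈ Ico (0 : ℝ) 1) (hy : 0 ≤ y) :
    dyadicAdd x (y - ⌊y⌋₊) ≤ dyadicAdd x y := by
  have h1 : ⌊y - ⌊y⌋₊⌋₊ = 0 := by
    rw [Nat.floor_sub_natCast, Nat.sub_self]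
  have h2 : dyadicAddFract x (y - ⌊y⌋₊) = dyadicAddFract x y := by
    unfold dyadicAddFract
    refine tsum_congr fun j => ?_
    have : digit (y - ⌊y⌋₊) j = digit y j := by
      unfold digit
      rw [show ((j : ℤ) + 1) = ((j + 1 : ℕ) : ℤ) by push_cast; ring, zpow_natCast, sub_mul,
        show (⌊y⌋₊ : ℝ) * 2 ^ (j + 1) = ((2 * (⌊y⌋₊ * 2 ^ j) : ℕ) : ℝ) by push_cast; ring,
        Nat.floor_sub_natCast]
      have : 2 * (⌊y⌋₊ * 2 ^ j) ≤ ⌊y * 2 ^ (j + 1)⌋₊ := by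
        refine Nat.le_floor ?_
        push_cast
        rw [pow_succ]
        nlinarith [Nat.floor_le hy, pow_pos (two_pos (α := ℝ)) j]
      omega
    rw [this]
  rw [dyadicAdd_eq, dyadicAdd_eq, h1, h2, (Nat.floor_eq_zero).2 hx.2]
  simp

lemma measurable_dyadicAdd (y : ℝ) : Measurable fun x => dyadicAdd x y := by
  refine measurable_of_tendsto_metrizable
    (f := fun (n : ℕ) x => ((⌊2 ^ n * x⌋₊ ^^^ ⌊2 ^ n * y⌋₊ : ℕ) : ℝ) / 2 ^ n) (fun n => ?_) ?_
  · have h : Measurable fun m : ℕ => ((m ^^^ ⌊2 ^ n * y⌋₊ : ℕ) : ℝ) / 2 ^ n := measurable_from_nat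
    exact h.comp (Nat.measurable_floor.comp (measurable_const_mul _))
  · rw [tendsto_pi_nhds]
    intro x
    have h0 : Tendsto (fun n : ℕ => dyadicAdd x y - (1 / 2 : ℝ) ^ n) atTop (𝓝 (dyadicAdd x y)) := by
      simpa using tendsto_const_nhds.sub
        (tendsto_pow_atTop_nhds_zero_of_lt_one (by norm_num) (by norm_num : (1 / 2 : ℝ) < 1))
    refine tendsto_of_tendsto_of_tendsto_of_le_of_le h0 tendsto_const_nhds (fun n => ?_)
      fun n => xor_floor_le_dyadicAdd n x y
    have := dyadicAdd_le_xor_floor n x y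
    rw [add_div] at this
    simp only [one_div, inv_pow] at this ⊢
    linarith

/-! ### Dyadic cells -/

/-- The `m`-th dyadic interval of length `2 ^ (-n)`. -/
def cell (n m : ℕ) : Set ℝ := Ico ((m : ℝ) / 2 ^ n) (((m : ℝ) + 1) / 2 ^ n)

lemma mem_cell {n m : ℕ} {x : ℝ} : x ∈ cell n m ↔ 0 ≤ x ∧ ⌊2 ^ n * x⌋₊ = m := by
  rw [cell, mem_Ico, div_le_iff₀' (by positivity), lt_div_iff₀' (by positivity)]
  constructor
  · rintro ⟨h1, h2⟩
    have h3 : 0 ≤ 2 ^ n * x := (Nat.cast_nonneg m).trans h1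
    exact ⟨nonneg_of_mul_nonneg_right h3 (by positivity), (Nat.floor_eq_iff h3).2 ⟨h1, h2⟩⟩
  · rintro ⟨h1, h2⟩
    exact (Nat.floor_eq_iff (by positivity)).1 h2

lemma measurableSet_cell (n m : ℕ) : MeasurableSet (cell n m) := measurableSet_Ico

lemma volume_cell (n m : ℕ) : volume (cell n m) = ENNReal.ofReal (1 / 2 ^ n) := by
  rw [cell, Real.volume_Ico]
  congr 1
  ring

lemma pairwise_disjoint_cell (n : ℕ) : Pairwise (Function.onFun Disjoint (cell n)) := by
  intro k m hkm
  refine Set.disjoint_left.2 fun x hk hm => hkm ?_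
  rw [← (mem_cell.1 hk).2, (mem_cell.1 hm).2]

lemma iUnion_cell (n : ℕ) : ⋃ m, cell n m = Ici (0 : ℝ) := by
  ext x
  simp [mem_cell]

lemma floor_two_pow_mul_lt {n : ℕ} {x : ℝ} (hx : x ∈ Ico (0 : ℝ) 1) : ⌊2 ^ n * x⌋₊ < 2 ^ n := by
  rw [Nat.floor_lt (mul_nonneg (by positivity) hx.1)]
  push_cast
  exact mul_lt_of_lt_one_right (by positivity) hx.2

lemma biUnion_cell (n : ℕ) : ⋃ m ∈ Finset.range (2 ^ n), cell n m = Ico (0 : ℝ) 1 := by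
  ext x
  simp only [mem_iUnion, mem_cell, Finset.mem_range, exists_prop]
  constructor
  · rintro ⟨m, hm, h0, rfl⟩
    refine ⟨h0, ?_⟩
    rw [Nat.floor_lt (by positivity)] at hm
    push_cast at hm
    exact (mul_lt_iff_lt_one_right (by positivity)).1 hm
  · intro hx
    exact ⟨_, floor_two_pow_mul_lt hx, hx.1, rfl⟩

lemma cell_eq_union (n m : ℕ) : cell n m = cell (n + 1) (2 * m) ∪ cell (n + 1) (2 * m + 1) := by
  have h : (m : ℝ) / 2 ^ n = ((2 * m : ℕ) : ℝ) / 2 ^ (n + 1) := by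
    rw [pow_succ]; push_cast; field_simp
  have h' : ((m : ℝ) + 1) / 2 ^ n = (((2 * m + 1 : ℕ) : ℝ) + 1) / 2 ^ (n + 1) := by
    rw [pow_succ]; push_cast; field_simp; ring
  have h'' : ((2 * m : ℕ) : ℝ) + 1 = ((2 * m + 1 : ℕ) : ℝ) := by push_cast; ring
  unfold cell
  rw [h, h', h'', Ico_union_Ico_eq_Ico]
  · gcongr; omega
  · gcongr; linarith

lemma floor_two_pow_succ (n : ℕ) (y : ℝ) : ⌊2 ^ n * y⌋₊ = ⌊2 ^ (n + 1) * y⌋₊ / 2 := by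
  rw [← Nat.floor_div_ofNat, pow_succ]
  congr 1
  ring

/-- The integral `∫ (x ⊕ y)² dx` over a cell. -/
noncomputable def cellMoment (n m : ℕ) (y : ℝ) : ℝ≥0∞ :=
  ∫⁻ x in cell n m, ENNReal.ofReal (dyadicAdd x y ^ 2)

/-- The number of the cell onto which `· ⊕ y` maps the cell `m` of length `2 ^ (-n)`. -/
noncomputable def shift (n m : ℕ) (y : ℝ) : ℕ := m ^^^ ⌊2 ^ n * y⌋₊

/-- The integral `∫ u² du = ((k + 1)³ - k³) / 3` over `[k, k + 1)`. -/
noncomputable def moment (k : ℕ) : ℝ := (((k : ℝ) + 1) ^ 3 - (k : ℝ) ^ 3) / 3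

lemma moment_nonneg (k : ℕ) : 0 ≤ moment k := by
  unfold moment
  have : (0 : ℝ) ≤ k := by positivity
  nlinarith

lemma cellMoment_split (n m : ℕ) (y : ℝ) :
    cellMoment n m y = cellMoment (n + 1) (2 * m) y + cellMoment (n + 1) (2 * m + 1) y := by
  unfold cellMoment
  rw [cell_eq_union, lintegral_union (measurableSet_cell _ _)]
  exact pairwise_disjoint_cell _ (by omega)

/-- The two halves of a cell are mapped onto the two halves of the image, in one of the two
orders. -/
lemma shift_halves (n m : ℕ) (y : ℝ) :
    (shift (n + 1) (2 * m) y = 2 * shift n m y ∧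
      shift (n + 1) (2 * m + 1) y = 2 * shift n m y + 1) ∨
    (shift (n + 1) (2 * m) y = 2 * shift n m y + 1 ∧
      shift (n + 1) (2 * m + 1) y = 2 * shift n m y) := by
  unfold shift
  rw [floor_two_pow_succ n]
  generalize ⌊2 ^ (n + 1) * y⌋₊ = q
  have d0 := Nat.xor_div_two_pow (a := 2 * m) (b := q) (n := 1)
  have d1 := Nat.xor_div_two_pow (a := 2 * m + 1) (b := q) (n := 1)
  have e0 := Nat.xor_mod_two_eq (m := 2 * m) (n := q)
  have e1 := Nat.xor_mod_two_eq (m := 2 * m + 1) (n := q)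
  rw [pow_one, show 2 * m / 2 = m by omega] at d0
  rw [pow_one, show (2 * m + 1) / 2 = m by omega] at d1
  omega

lemma cellMoment_bounds (n m : ℕ) (y : ℝ) :
    ENNReal.ofReal ((shift n m y : ℝ) ^ 2 / 8 ^ n) ≤ cellMoment n m y ∧
    cellMoment n m y ≤ ENNReal.ofReal (((shift n m y : ℝ) + 1) ^ 2 / 8 ^ n) := by
  have key (r : ℝ) (hr : 0 ≤ r) : ENNReal.ofReal (r ^ 2 / 8 ^ n) =
      ∫⁻ _ in cell n m, ENNReal.ofReal ((r / 2 ^ n) ^ 2) := by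
    rw [setLIntegral_const, volume_cell, ← ENNReal.ofReal_mul (by positivity)]
    congr 1
    rw [show (8 : ℝ) = 2 ^ 3 by norm_num, ← pow_mul]
    field_simp
    ring
  rw [key _ (by positivity), key _ (by positivity)]
  constructor <;> refine setLIntegral_mono' (measurableSet_cell _ _) fun x hx => ?_
  · have h := xor_floor_le_dyadicAdd n x y
    rw [(mem_cell.1 hx).2] at h
    exact ENNReal.ofReal_le_ofReal (pow_le_pow_left₀ (by positivity) h 2)
  · have h := dyadicAdd_le_xor_floor n x y
    rw [(mem_cell.1 hx).2] at h
    exact ENNReal.ofReal_le_ofReal (pow_le_pow_left₀ (dyadicAdd_nonneg x y) h 2)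

/-- Each bisection halves the bound for the distance between the integrals of `(x ⊕ y)²` over a cell
and of `u²` over its image. -/
lemma cellMoment_approx (N n m : ℕ) (y : ℝ) :
    ENNReal.ofReal ((moment (shift n m y) - (2 * shift n m y + 1) / 2 ^ N) / 8 ^ n) ≤
      cellMoment n m y ∧
    cellMoment n m y ≤
      ENNReal.ofReal ((moment (shift n m y) + (2 * shift n m y + 1) / 2 ^ N) / 8 ^ n) := by
  induction N generalizing n m with
  | zero =>
    obtain ⟨h1, h2⟩ := cellMoment_bounds n m y
    have hs : (0 : ℝ) ≤ shift n m y := by positivity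
    refine ⟨le_trans (ENNReal.ofReal_le_ofReal ?_) h1, h2.trans (ENNReal.ofReal_le_ofReal ?_)⟩ <;>
    · gcongr
      unfold moment
      nlinarith
  | succ N ih =>
    obtain ⟨l0, u0⟩ := ih (n + 1) (2 * m)
    obtain ⟨l1, u1⟩ := ih (n + 1) (2 * m + 1)
    rw [cellMoment_split]
    have hk : (0 : ℝ) ≤ shift n m y := by positivity
    constructor
    · refine le_trans (le_trans (ENNReal.ofReal_le_ofReal (le_of_eq ?_)) ENNReal.ofReal_add_le)
        (add_le_add l0 l1)
      rcases shift_halves n m y with ⟨e0, e1⟩ | ⟨e0, e1⟩ <;>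
      · rw [e0, e1]
        unfold moment
        push_cast
        rw [pow_succ, pow_succ]
        field_simp
        ring
    · refine (add_le_add u0 u1).trans ?_
      rw [← ENNReal.ofReal_add]
      · refine ENNReal.ofReal_le_ofReal (le_of_eq ?_)
        rcases shift_halves n m y with ⟨e0, e1⟩ | ⟨e0, e1⟩ <;>
        · rw [e0, e1]
          unfold moment
          push_cast
          rw [pow_succ, pow_succ]
          field_simp
          ring
      all_goals exact div_nonneg (add_nonneg (moment_nonneg _) (by positivity)) (by positivity)

/-- Since `· ⊕ y` maps a cell onto another one and preserves measure, `∫ (x ⊕ y)² dx` over a cell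
is the integral of `u²` over its image. -/
lemma cellMoment_eq (n m : ℕ) (y : ℝ) :
    cellMoment n m y = ENNReal.ofReal (moment (shift n m y) / 8 ^ n) := by
  have h0 : Tendsto (fun N : ℕ => (2 * (shift n m y : ℝ) + 1) / 2 ^ N) atTop (𝓝 0) :=
    tendsto_const_nhds.div_atTop (tendsto_pow_atTop_atTop_of_one_lt (by norm_num))
  refine le_antisymm ?_ ?_
  · have h1 : Tendsto (fun N : ℕ => ENNReal.ofReal
        ((moment (shift n m y) + (2 * shift n m y + 1) / 2 ^ N) / 8 ^ n)) atTop
        (𝓝 (ENNReal.ofReal ((moment (shift n m y) + 0) / 8 ^ n))) :=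
      ENNReal.tendsto_ofReal ((tendsto_const_nhds.add h0).div_const _)
    rw [add_zero] at h1
    exact ge_of_tendsto' h1 fun N => (cellMoment_approx N n m y).2
  · have h1 : Tendsto (fun N : ℕ => ENNReal.ofReal
        ((moment (shift n m y) - (2 * shift n m y + 1) / 2 ^ N) / 8 ^ n)) atTop
        (𝓝 (ENNReal.ofReal ((moment (shift n m y) - 0) / 8 ^ n))) :=
      ENNReal.tendsto_ofReal ((tendsto_const_nhds.sub h0).div_const _)
    rw [sub_zero] at h1
    exact le_of_tendsto' h1 fun N => (cellMoment_approx N n m y).1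

/-! ### Walsh functions on the unit interval -/

/-- The sign `∏_{i < n} (-1) ^ (k_i p_{n-1-i})` for the binary digits `k_i`, `p_i` of `k`, `p`: the
value of the Walsh function of number `k < 2 ^ n` on the `p`-th cell of length `2 ^ (-n)`. -/
noncomputable def walshSign (n k p : ℕ) : ℝ :=
  ∏ i ∈ Finset.range n, (-1) ^ ((k / 2 ^ i % 2) * (p / 2 ^ (n - 1 - i) % 2))

lemma walshSign_comm (n k p : ℕ) : walshSign n k p = walshSign n p k := by
  unfold walshSign
  rw [← Finset.prod_range_reflect]
  refine Finset.prod_congr rfl fun i hi => ?_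
  have := Finset.mem_range.1 hi
  rw [show n - 1 - (n - 1 - i) = i by omega, mul_comm]

lemma digit_eq_bit {n i : ℕ} (hi : i < n) (x : ℝ) :
    digit x i = ⌊2 ^ n * x⌋₊ / 2 ^ (n - 1 - i) % 2 := by
  have h : x * (2 : ℝ) ^ ((i : ℤ) + 1) = 2 ^ n * x / ((2 ^ (n - 1 - i) : ℕ) : ℝ) := by
    rw [eq_div_iff (by positivity), show (i : ℤ) + 1 = ((i + 1 : ℕ) : ℤ) by push_cast; ring,
      zpow_natCast]
    push_cast
    rw [mul_assoc, ← pow_add, show i + 1 + (n - 1 - i) = n by omega, mul_comm]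
  rw [digit, h, Nat.floor_div_natCast]

/-- On `[0, 1)` only the integer part of `t` matters, and `w(t, ·)` is constant on the cells of
length `2 ^ (-n)` as soon as `⌊t⌋ < 2 ^ n`. -/
lemma walsh_eq_walshSign {n : ℕ} {t x : ℝ} (ht : ⌊t⌋₊ < 2 ^ n) (hx : x ∈ Ico (0 : ℝ) 1) :
    walsh t x = walshSign n ⌊t⌋₊ ⌊2 ^ n * x⌋₊ := by
  have hinj : Function.Injective fun i : ℕ => -((i : ℤ) + 1) := fun i j h => by
    simp only at h
    omega
  have hsum : ∑ᶠ j : ℤ, digit t j * digit x (-j - 1) =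
      ∑ i ∈ Finset.range n, (⌊t⌋₊ / 2 ^ i % 2) * (⌊2 ^ n * x⌋₊ / 2 ^ (n - 1 - i) % 2) := by
    rw [finsum_eq_sum_of_support_subset (s := (Finset.range n).image fun i : ℕ => -((i : ℤ) + 1)),
      Finset.sum_image hinj.injOn]
    · refine Finset.sum_congr rfl fun i hi => ?_
      rw [digit_neg, show -(-((i : ℤ) + 1)) - 1 = (i : ℤ) by ring,
        digit_eq_bit (Finset.mem_range.1 hi)]
    · intro j hj
      by_contra hjn
      refine hj ?_
      rcases le_or_gt 0 j with h | h
      · obtain ⟨i, rfl⟩ := Int.eq_ofNat_of_zero_le h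
        simp only
        rw [show -(i : ℤ) - 1 = -((i : ℤ) + 1) by ring, digit_neg x,
          Nat.floor_eq_zero.2 hx.2]
        simp
      · obtain ⟨i, rfl⟩ : ∃ i : ℕ, j = -((i : ℤ) + 1) := ⟨(-j - 1).toNat, by omega⟩
        simp only
        rw [digit_neg]
        have hi : n ≤ i := by
          by_contra hi
          exact hjn (Finset.mem_coe.2 (Finset.mem_image_of_mem _ (Finset.mem_range.2 (not_le.1 hi))))
        rw [Nat.div_eq_of_lt (ht.trans_le (Nat.pow_le_pow_right two_pos hi))]
        simp
  rw [walsh, hsum, ← Finset.prod_pow_eq_pow_sum]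
  rfl

/-- A product over the binary digits, summed over all `p < 2 ^ n`, factorizes. -/
lemma sum_prod_bits (n : ℕ) (g : ℕ → ℕ → ℝ) :
    ∑ p ∈ Finset.range (2 ^ n), ∏ i ∈ Finset.range n, g i (p / 2 ^ i % 2) =
      ∏ i ∈ Finset.range n, (g i 0 + g i 1) := by
  induction n with
  | zero => simp
  | succ n ih =>
    rw [pow_succ, mul_two, Finset.sum_range_add, Finset.prod_range_succ, ← ih, mul_add,
      Finset.sum_mul, Finset.sum_mul]
    congr 1 <;> refine Finset.sum_congr rfl fun p hp => ?_ <;> rw [Finset.prod_range_succ] <;>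
      have hp' := Finset.mem_range.1 hp
    · rw [Nat.div_eq_of_lt hp']
    · congr 1
      · refine Finset.prod_congr rfl fun i hi => ?_
        have hi' := Finset.mem_range.1 hi
        congr 1
        rw [show 2 ^ n + p = p + 2 ^ i * (2 * 2 ^ (n - i - 1)) by
            rw [← pow_succ', ← pow_add, add_comm]; congr 2; omega,
          Nat.add_mul_div_left _ _ (by positivity), Nat.add_mul_mod_self_left]
      · rw [Nat.add_div_left _ (by positivity), Nat.div_eq_of_lt hp']

/-- Orthogonality of the Walsh functions. -/
lemma sum_walshSign_mul (n : ℕ) {k l : ℕ} (hk : k < 2 ^ n) (hl : l < 2 ^ n) :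
    ∑ p ∈ Finset.range (2 ^ n), walshSign n k p * walshSign n l p = if k = l then 2 ^ n else 0 := by
  have h : ∀ p, walshSign n k p * walshSign n l p = ∏ i ∈ Finset.range n,
      (fun i b : ℕ => ((-1 : ℝ) ^ (b * (k / 2 ^ (n - 1 - i) % 2)) *
        (-1) ^ (b * (l / 2 ^ (n - 1 - i) % 2)))) i (p / 2 ^ i % 2) := by
    intro p
    rw [walshSign_comm n k, walshSign_comm n l, walshSign, walshSign, ← Finset.prod_mul_distrib]
  rw [Finset.sum_congr rfl fun p _ => h p, sum_prod_bits n fun i b : ℕ =>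
    ((-1 : ℝ) ^ (b * (k / 2 ^ (n - 1 - i) % 2)) * (-1) ^ (b * (l / 2 ^ (n - 1 - i) % 2)))]
  split_ifs with hkl
  · subst hkl
    rw [Finset.prod_congr rfl (g := fun _ => (2 : ℝ))]
    · simp
    · intro i _
      rcases Nat.mod_two_eq_zero_or_one (k / 2 ^ (n - 1 - i)) with h | h <;> rw [h] <;> norm_num
  · obtain ⟨i, hi, hne⟩ : ∃ i < n, k / 2 ^ i % 2 ≠ l / 2 ^ i % 2 := by
      by_contra! hcon
      have e1 := sum_range_bits k n
      have e2 := sum_range_bits l n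
      rw [Nat.div_eq_of_lt hk, zero_mul, add_zero] at e1
      rw [Nat.div_eq_of_lt hl, zero_mul, add_zero] at e2
      refine hkl (e1.symm.trans (Eq.trans (Finset.sum_congr rfl fun i hi => ?_) e2))
      rw [hcon i (Finset.mem_range.1 hi)]
    refine Finset.prod_eq_zero (Finset.mem_range.2 (show n - 1 - i < n by omega)) ?_
    simp only [show n - 1 - (n - 1 - i) = i by omega]
    rcases Nat.mod_two_eq_zero_or_one (k / 2 ^ i) with h | h <;>
      rcases Nat.mod_two_eq_zero_or_one (l / 2 ^ i) with h' | h' <;> rw [h, h'] at hne ⊢ <;>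
      simp at hne ⊢

/-- Parseval's identity for the discrete Walsh transform. -/
lemma sum_norm_sq_walshSign (n : ℕ) (a : ℕ → ℂ) :
    ∑ p ∈ Finset.range (2 ^ n), ‖∑ k ∈ Finset.range (2 ^ n), a k * (walshSign n k p : ℂ)‖ ^ 2 =
      2 ^ n * ∑ k ∈ Finset.range (2 ^ n), ‖a k‖ ^ 2 := by
  have key : ∑ p ∈ Finset.range (2 ^ n),
      ((∑ k ∈ Finset.range (2 ^ n), a k * (walshSign n k p : ℂ)) *
        (starRingEnd ℂ) (∑ k ∈ Finset.range (2 ^ n), a k * (walshSign n k p : ℂ))) =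
      2 ^ n * ∑ k ∈ Finset.range (2 ^ n), a k * (starRingEnd ℂ) (a k) := by
    simp only [map_sum, map_mul, Complex.conj_ofReal, Finset.sum_mul_sum]
    rw [Finset.sum_comm, Finset.mul_sum]
    refine Finset.sum_congr rfl fun k hk => ?_
    rw [Finset.sum_comm]
    have : ∀ l ∈ Finset.range (2 ^ n), ∑ p ∈ Finset.range (2 ^ n),
        a k * (walshSign n k p : ℂ) * ((starRingEnd ℂ) (a l) * (walshSign n l p : ℂ)) =
        if k = l then 2 ^ n * (a k * (starRingEnd ℂ) (a l)) else 0 := by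
      intro l hl
      have := sum_walshSign_mul n (Finset.mem_range.1 hk) (Finset.mem_range.1 hl)
      calc _ = a k * (starRingEnd ℂ) (a l) *
          ((∑ p ∈ Finset.range (2 ^ n), walshSign n k p * walshSign n l p : ℝ) : ℂ) := by
            push_cast
            rw [Finset.mul_sum]
            exact Finset.sum_congr rfl fun p _ => by ring
        _ = _ := by
            rw [this]
            split_ifs <;> push_cast <;> ring
    rw [Finset.sum_congr rfl this, Finset.sum_ite_eq, if_pos hk]
  simp only [Complex.mul_conj'] at key
  exact_mod_cast key

/-! ### Walsh–Fourier transforms of functions on the unit interval -/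

lemma integral_floor (n : ℕ) (φ : ℕ → ℂ) :
    IntegrableOn (fun x : ℝ => φ ⌊2 ^ n * x⌋₊) (Ico 0 1) ∧
    ∫ x in Ico (0 : ℝ) 1, φ ⌊2 ^ n * x⌋₊ = (∑ p ∈ Finset.range (2 ^ n), φ p) / 2 ^ n := by
  have hc : ∀ p, EqOn (fun x : ℝ => φ ⌊2 ^ n * x⌋₊) (fun _ => φ p) (cell n p) := fun p x hx => by
    simp only [(mem_cell.1 hx).2]
  have hi : ∀ p, IntegrableOn (fun x : ℝ => φ ⌊2 ^ n * x⌋₊) (cell n p) := fun p => by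
    rw [integrableOn_congr_fun (hc p) (measurableSet_cell n p)]
    exact integrableOn_const (by simp [volume_cell])
  rw [← biUnion_cell n]
  refine ⟨integrableOn_finset_iUnion.2 fun p _ => hi p, ?_⟩
  rw [integral_biUnion_finset _ (fun p _ => measurableSet_cell n p)
    (fun p _ q _ hpq => pairwise_disjoint_cell n hpq) fun p _ => hi p, Finset.sum_div]
  refine Finset.sum_congr rfl fun p _ => ?_
  rw [setIntegral_congr_fun (measurableSet_cell n p) (hc p), setIntegral_const, measureReal_def,
    volume_cell, ENNReal.toReal_ofReal (by positivity), Complex.real_smul]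
  push_cast
  ring

lemma integrableOn_walsh_mul (s t : ℝ) :
    IntegrableOn (fun x => (walsh s x : ℂ) * walsh t x) (Ico 0 1) ∧
    ∫ x in Ico (0 : ℝ) 1, (walsh s x : ℂ) * walsh t x = if ⌊s⌋₊ = ⌊t⌋₊ then 1 else 0 := by
  obtain ⟨n, hs, ht⟩ : ∃ n, ⌊s⌋₊ < 2 ^ n ∧ ⌊t⌋₊ < 2 ^ n :=
    ⟨⌊s⌋₊ + ⌊t⌋₊, Nat.lt_two_pow_self.trans_le (Nat.pow_le_pow_right two_pos (by omega)),
      Nat.lt_two_pow_self.trans_le (Nat.pow_le_pow_right two_pos (by omega))⟩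
  have h := integral_floor n fun p => (walshSign n ⌊s⌋₊ p : ℂ) * walshSign n ⌊t⌋₊ p
  have he : EqOn (fun x => (walsh s x : ℂ) * walsh t x)
      (fun x => (walshSign n ⌊s⌋₊ ⌊2 ^ n * x⌋₊ : ℂ) * walshSign n ⌊t⌋₊ ⌊2 ^ n * x⌋₊)
      (Ico 0 1) := fun x hx => by
    simp only [walsh_eq_walshSign hs hx, walsh_eq_walshSign ht hx]
  refine ⟨(integrableOn_congr_fun he measurableSet_Ico).2 h.1, ?_⟩
  rw [setIntegral_congr_fun measurableSet_Ico he, h.2]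
  have := sum_walshSign_mul n hs ht
  have h2 : ∑ p ∈ Finset.range (2 ^ n), (walshSign n ⌊s⌋₊ p : ℂ) * walshSign n ⌊t⌋₊ p =
      if ⌊s⌋₊ = ⌊t⌋₊ then 2 ^ n else 0 := by
    have h3 := congrArg Complex.ofReal this
    push_cast [apply_ite Complex.ofReal] at h3
    exact h3
  rw [h2]
  split_ifs <;> simp

lemma norm_walsh (t x : ℝ) : ‖(walsh t x : ℂ)‖ = 1 := by
  simp [walsh]

/-- The Walsh coefficients of a Walsh polynomial. -/
lemma integral_walshSum_mul (a : ℕ → ℂ) (N : ℕ) (t : ℝ) :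
    IntegrableOn (fun x => walshSum a N x * walsh t x) (Ico 0 1) ∧
    ∫ x in Ico (0 : ℝ) 1, walshSum a N x * walsh t x = if ⌊t⌋₊ < N then a ⌊t⌋₊ else 0 := by
  have he : (fun x => walshSum a N x * walsh t x) =
      fun x => ∑ k ∈ Finset.range N, a k * ((walsh k x : ℂ) * walsh t x) := by
    ext x
    rw [walshSum, Finset.sum_mul]
    exact Finset.sum_congr rfl fun k _ => by ring
  have hi : ∀ k ∈ Finset.range N, IntegrableOn
      (fun x => a k * ((walsh k x : ℂ) * walsh t x)) (Ico 0 1) :=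
    fun k _ => (integrableOn_walsh_mul k t).1.const_mul _
  rw [he]
  refine ⟨integrable_finsetSum _ hi, ?_⟩
  rw [integral_finsetSum _ hi]
  simp only [integral_const_mul, (integrableOn_walsh_mul _ t).2, Nat.floor_natCast, mul_ite, mul_one,
    mul_zero, Finset.sum_ite_eq', Finset.mem_range]

lemma walshFourier_eq_setIntegral {f : ℝ → ℂ} (hf : ∀ x ∉ Ico (0 : ℝ) 1, f x = 0) (t : ℝ) :
    walshFourier f t = ∫ x in Ico (0 : ℝ) 1, f x * walsh t x :=
  setIntegral_eq_of_subset_of_forall_sdiff_eq_zero measurableSet_Ici Ico_subset_Ici_self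
    fun x hx => by rw [hf x hx.2, zero_mul]

lemma walshFourier_dyadicPartialSum (a : ℕ → ℂ) (n : ℕ) (t : ℝ) :
    walshFourier (dyadicPartialSum a n) t = if ⌊t⌋₊ < 2 ^ n then a ⌊t⌋₊ else 0 := by
  rw [walshFourier_eq_setIntegral (f := dyadicPartialSum a n)
      (fun x hx => indicator_of_notMem hx _),
    ← (integral_walshSum_mul a (2 ^ n) t).2]
  refine setIntegral_congr_fun measurableSet_Ico fun x hx => ?_
  simp only [dyadicPartialSum, indicator_of_mem hx]

lemma norm_walshSum_le (a : ℕ → ℂ) (N : ℕ) (x : ℝ) :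
    ‖walshSum a N x‖ ≤ ∑ k ∈ Finset.range N, ‖a k‖ :=
  norm_sum_le_of_le _ fun k _ => by rw [norm_mul, norm_walsh, mul_one]

lemma exists_bound {a : ℕ → ℂ} {f : ℝ → ℂ}
    (hconv : TendstoUniformlyOn (walshSum a) f atTop (Ico (0 : ℝ) 1)) :
    ∃ C : ℝ, 0 ≤ C ∧ ∀ x ∈ Ico (0 : ℝ) 1, ‖f x‖ ≤ C := by
  obtain ⟨N, hN⟩ := (Metric.tendstoUniformlyOn_iff.1 hconv 1 one_pos).exists
  refine ⟨1 + ∑ k ∈ Finset.range N, ‖a k‖, by positivity, fun x hx => ?_⟩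
  have h := hN x hx
  rw [dist_eq_norm] at h
  calc ‖f x‖ = ‖(f x - walshSum a N x) + walshSum a N x‖ := by rw [sub_add_cancel]
    _ ≤ _ := (norm_add_le _ _).trans (add_le_add h.le (norm_walshSum_le a N x))

/-- The coefficients of a uniformly convergent Walsh series are the Walsh–Fourier transform of its
sum. -/
lemma walshFourier_eq_coeff {a : ℕ → ℂ} {f : ℝ → ℂ}
    (hconv : TendstoUniformlyOn (walshSum a) f atTop (Ico (0 : ℝ) 1))
    (hsupp : ∀ x ∉ Ico (0 : ℝ) 1, f x = 0) (t : ℝ) : walshFourier f t = a ⌊t⌋₊ := by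
  rw [walshFourier_eq_setIntegral hsupp]
  obtain ⟨C, _, hC⟩ := exists_bound hconv
  have h1 : Tendsto (fun N => ∫ x in Ico (0 : ℝ) 1, walshSum a N x * walsh t x) atTop
      (𝓝 (∫ x in Ico (0 : ℝ) 1, f x * walsh t x)) := by
    refine tendsto_integral_filter_of_dominated_convergence (fun _ => C + 1) ?_ ?_ ?_ ?_
    · exact Eventually.of_forall fun N => (integral_walshSum_mul a N t).1.aestronglyMeasurable
    · filter_upwards [Metric.tendstoUniformlyOn_iff.1 hconv 1 one_pos] with N hN
      refine ae_restrict_of_forall_mem measurableSet_Ico fun x hx => ?_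
      have h := hN x hx
      rw [dist_comm, dist_eq_norm] at h
      rw [norm_mul, norm_walsh, mul_one]
      calc ‖walshSum a N x‖ = ‖f x + (walshSum a N x - f x)‖ := by rw [add_sub_cancel]
        _ ≤ _ := (norm_add_le _ _).trans (add_le_add (hC x hx) h.le)
    · exact integrableOn_const (by simp)
    · exact ae_restrict_of_forall_mem measurableSet_Ico fun x hx =>
        (hconv.tendsto_at hx).mul_const _
  refine tendsto_nhds_unique h1 (tendsto_const_nhds.congr' ?_)
  filter_upwards [eventually_gt_atTop ⌊t⌋₊] with N hN
  rw [(integral_walshSum_mul a N t).2, if_pos hN]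

/-! ### `V` of dyadic step functions -/

/-- The second moment about the `q`-th unit cell of the step function with value `b m` on
`[m, m + 1)`. -/
noncomputable def stepMoment (b : ℕ → ℂ) (q : ℕ) : ℝ≥0∞ :=
  ∑' m, ‖b m‖ₑ ^ 2 * ENNReal.ofReal (moment (m ^^^ q))

lemma lintegral_dyadicAdd_step {n : ℕ} {b : ℕ → ℂ} {g : ℝ → ℂ}
    (hg : ∀ x, 0 ≤ x → g x = b ⌊2 ^ n * x⌋₊) (y : ℝ) :
    ∫⁻ x in Ici (0 : ℝ), ENNReal.ofReal (dyadicAdd x y ^ 2) * ‖g x‖ₑ ^ 2 =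
      ENNReal.ofReal (1 / 8 ^ n) * stepMoment b ⌊2 ^ n * y⌋₊ := by
  rw [← iUnion_cell n, lintegral_iUnion (measurableSet_cell n) (pairwise_disjoint_cell n),
    stepMoment, ← ENNReal.tsum_mul_left]
  refine tsum_congr fun m => ?_
  rw [setLIntegral_congr_fun (g := fun x => ENNReal.ofReal (dyadicAdd x y ^ 2) * ‖b m‖ₑ ^ 2)
    (measurableSet_cell n m) fun x hx => ?_]
  · rw [lintegral_mul_const' _ _ (by simp)]
    change cellMoment n m y * _ = _
    rw [cellMoment_eq, shift, div_eq_mul_one_div, ENNReal.ofReal_mul (moment_nonneg _)]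
    ring
  · obtain ⟨h0, h1⟩ := mem_cell.1 hx
    simp only [hg x h0, h1]

lemma lintegral_sq_step {n : ℕ} {b : ℕ → ℂ} {g : ℝ → ℂ}
    (hg : ∀ x, 0 ≤ x → g x = b ⌊2 ^ n * x⌋₊) :
    ∫⁻ x in Ici (0 : ℝ), ‖g x‖ₑ ^ 2 = ENNReal.ofReal (1 / 2 ^ n) * ∑' m, ‖b m‖ₑ ^ 2 := by
  rw [← iUnion_cell n, lintegral_iUnion (measurableSet_cell n) (pairwise_disjoint_cell n),
    ← ENNReal.tsum_mul_left]
  refine tsum_congr fun m => ?_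
  rw [setLIntegral_congr_fun (g := fun _ => ‖b m‖ₑ ^ 2)
    (measurableSet_cell n m) fun x hx => ?_]
  · rw [setLIntegral_const, volume_cell, mul_comm]
  · obtain ⟨h0, h1⟩ := mem_cell.1 hx
    simp only [hg x h0, h1]

lemma iInf_lintegral_step {n : ℕ} {b : ℕ → ℂ} {g : ℝ → ℂ}
    (hg : ∀ x, 0 ≤ x → g x = b ⌊2 ^ n * x⌋₊) :
    ⨅ y ∈ Ici (0 : ℝ), ∫⁻ x in Ici (0 : ℝ), ENNReal.ofReal (dyadicAdd x y ^ 2) * ‖g x‖ₑ ^ 2 =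
      ENNReal.ofReal (1 / 8 ^ n) * ⨅ q, stepMoment b q := by
  simp only [lintegral_dyadicAdd_step hg]
  rw [ENNReal.mul_iInf_of_ne (by simp) (by simp)]
  refine le_antisymm (le_iInf fun q => ?_) (le_iInf₂ fun y _ => iInf_le _ _)
  refine (iInf₂_le ((q : ℝ) / 2 ^ n) (mem_Ici.2 (by positivity))).trans (le_of_eq ?_)
  rw [mul_div_cancel₀ _ (by positivity), Nat.floor_natCast]

lemma moment_mono : Monotone moment := by
  refine monotone_nat_of_le_succ fun k => ?_
  unfold moment
  push_cast
  have : (0 : ℝ) ≤ k := by positivity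
  nlinarith

lemma tsum_eq_ofReal_sum {N : ℕ} {b : ℕ → ℂ} (hb : ∀ m, N ≤ m → b m = 0) (r : ℕ → ℝ)
    (hr : ∀ m, 0 ≤ r m) :
    ∑' m, ‖b m‖ₑ ^ 2 * ENNReal.ofReal (r m) = ENNReal.ofReal (∑ k : Fin N, ‖b k‖ ^ 2 * r k) := by
  rw [tsum_eq_sum (s := Finset.range N), Finset.sum_range, ENNReal.ofReal_sum_of_nonneg]
  · refine Finset.sum_congr rfl fun k _ => ?_
    rw [ENNReal.ofReal_mul (by positivity), ENNReal.ofReal_pow (norm_nonneg _), ofReal_norm]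
  · exact fun k _ => mul_nonneg (by positivity) (hr k)
  · intro m hm
    rw [hb m (by simpa using hm)]
    simp

lemma stepMoment_eq_ofReal {N : ℕ} {b : ℕ → ℂ} (hb : ∀ m, N ≤ m → b m = 0) (q : ℕ) :
    stepMoment b q = ENNReal.ofReal (∑ k : Fin N, ‖b k‖ ^ 2 * moment (k ^^^ q)) :=
  tsum_eq_ofReal_sum hb _ fun _ => moment_nonneg _

/-- Reducing `q` modulo `2 ^ N` does not increase the moment of a sequence supported below
`2 ^ N`. -/
lemma stepMoment_mod_le {N : ℕ} {b : ℕ → ℂ} (hb : ∀ m, 2 ^ N ≤ m → b m = 0) (q : ℕ) :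
    stepMoment b (q % 2 ^ N) ≤ stepMoment b q := by
  refine ENNReal.tsum_le_tsum fun m => ?_
  rcases lt_or_ge m (2 ^ N) with h | h
  · have : m ^^^ (q % 2 ^ N) = (m ^^^ q) % 2 ^ N := by
      rw [Nat.xor_mod_two_pow, Nat.mod_eq_of_lt h]
    gcongr
    rw [this]
    exact moment_mono (Nat.mod_le _ _)
  · simp [hb m h]

lemma fin_xor_val {N : ℕ} (k l : Fin (2 ^ N)) : ((k ^^^ l : Fin (2 ^ N)) : ℕ) = k ^^^ (l : ℕ) := by
  rw [Fin.xor_val_of_two_pow]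

lemma sum_fin_xor {N : ℕ} (l : Fin (2 ^ N)) (F : Fin (2 ^ N) → ℝ) :
    ∑ k, F (k ^^^ l) = ∑ k, F k := by
  have h : Function.Involutive fun k : Fin (2 ^ N) => k ^^^ l := fun k => by
    apply Fin.ext
    simp only [fin_xor_val, Nat.xor_assoc, Nat.xor_self, Nat.xor_zero]
  exact Equiv.sum_comp h.toPerm F

lemma iInf_stepMoment {N : ℕ} {b : ℕ → ℂ} (hb : ∀ m, 2 ^ N ≤ m → b m = 0) {s : ℝ} (hs : 0 < s) :
    ENNReal.ofReal s * ⨅ q, stepMoment b q =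
      ENNReal.ofReal (Finset.univ.inf' Finset.univ_nonempty fun l : Fin (2 ^ N) =>
        ∑ k : Fin (2 ^ N), s * (‖b ((k ^^^ l : Fin (2 ^ N)) : ℕ)‖ ^ 2 * moment k)) := by
  have key (l : Fin (2 ^ N)) : ENNReal.ofReal
      (∑ k : Fin (2 ^ N), s * (‖b ((k ^^^ l : Fin (2 ^ N)) : ℕ)‖ ^ 2 * moment k)) =
      ENNReal.ofReal s * stepMoment b l := by
    rw [stepMoment_eq_ofReal hb, ← ENNReal.ofReal_mul hs.le, ← Finset.mul_sum, ← sum_fin_xor l]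
    congr 2
    refine Finset.sum_congr rfl fun k _ => ?_
    simp only [fin_xor_val, Nat.xor_assoc, Nat.xor_self, Nat.xor_zero]
  refine le_antisymm ?_ ?_
  · obtain ⟨l, -, hl⟩ := Finset.exists_mem_eq_inf' (Finset.univ_nonempty)
      fun l : Fin (2 ^ N) =>
        ∑ k : Fin (2 ^ N), s * (‖b ((k ^^^ l : Fin (2 ^ N)) : ℕ)‖ ^ 2 * moment k)
    rw [hl, key]
    gcongr
    exact iInf_le _ _
  · rw [ENNReal.mul_iInf_of_ne (by simpa using hs) (by simp)]
    refine le_iInf fun q => ?_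
    have hq : q % 2 ^ N < 2 ^ N := Nat.mod_lt _ (by positivity)
    refine (ENNReal.ofReal_le_ofReal (Finset.inf'_le _ (Finset.mem_univ ⟨q % 2 ^ N, hq⟩))).trans ?_
    rw [key]
    gcongr
    exact stepMoment_mod_le hb q

/-- `V` of a step function on the cells of length `2 ^ (-n)` that vanishes off the first `2 ^ N` of
them; the minimum is over the number `l` of the cell that contains `y`. -/
lemma V_step {n N : ℕ} {b : ℕ → ℂ} {g : ℝ → ℂ} (hg : ∀ x, 0 ≤ x → g x = b ⌊2 ^ n * x⌋₊)
    (hb : ∀ m, 2 ^ N ≤ m → b m = 0) :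
    V g = ENNReal.ofReal
      ((Finset.univ.inf' Finset.univ_nonempty fun l : Fin (2 ^ N) => ∑ k : Fin (2 ^ N),
          1 / 8 ^ n * (‖b ((k ^^^ l : Fin (2 ^ N)) : ℕ)‖ ^ 2 * moment k)) /
        (1 / 2 ^ n * ∑ k : Fin (2 ^ N), ‖b k‖ ^ 2)) := by
  have hD : ∑' m, ‖b m‖ₑ ^ 2 = ENNReal.ofReal (∑ k : Fin (2 ^ N), ‖b k‖ ^ 2) := by
    simpa using tsum_eq_ofReal_sum hb (fun _ => 1) (fun _ => zero_le_one)
  rw [V, iInf_lintegral_step hg, lintegral_sq_step hg, iInf_stepMoment hb (by positivity), hD,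
    ← ENNReal.ofReal_mul (by positivity)]
  rcases (show 0 ≤ ∑ k : Fin (2 ^ N), ‖b k‖ ^ 2 by positivity).eq_or_lt with h | h
  · -- If `b = 0`, both sides are `0 / 0 = 0`.
    have hz : ∀ k : Fin (2 ^ N), ‖b k‖ ^ 2 = 0 := fun k =>
      (Finset.sum_eq_zero_iff_of_nonneg fun _ _ => by positivity).1 h.symm k (Finset.mem_univ k)
    simp only [hz]
    simp
  · rw [ENNReal.ofReal_div_of_pos (by positivity)]

/-- The value of `dyadicPartialSum a n` on the `p`-th cell of length `2 ^ (-n)`. -/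
noncomputable def cellValue (a : ℕ → ℂ) (n p : ℕ) : ℂ :=
  if p < 2 ^ n then ∑ k ∈ Finset.range (2 ^ n), a k * (walshSign n k p : ℂ) else 0

lemma dyadicPartialSum_eq (a : ℕ → ℂ) (n : ℕ) (x : ℝ) (hx : 0 ≤ x) :
    dyadicPartialSum a n x = cellValue a n ⌊2 ^ n * x⌋₊ := by
  unfold dyadicPartialSum cellValue
  by_cases h : x ∈ Ico (0 : ℝ) 1
  · rw [indicator_of_mem h, if_pos (floor_two_pow_mul_lt h), walshSum]
    refine Finset.sum_congr rfl fun k hk => ?_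
    rw [walsh_eq_walshSign (n := n) (by simpa using hk) h, Nat.floor_natCast]
  · rw [indicator_of_notMem h, if_neg]
    rw [Nat.floor_lt (by positivity)]
    push_cast
    exact fun h' => h ⟨hx, (mul_lt_iff_lt_one_right (by positivity)).1 h'⟩

lemma cellValue_of_le {a : ℕ → ℂ} {n m : ℕ} (hm : 2 ^ n ≤ m) : cellValue a n m = 0 :=
  if_neg hm.not_gt

/-- The sequence `a` cut off at the index `2 ^ n`. -/
noncomputable def trunc (a : ℕ → ℂ) (n m : ℕ) : ℂ := if m < 2 ^ n then a m else 0

lemma trunc_of_le {a : ℕ → ℂ} {n m : ℕ} (hm : 2 ^ n ≤ m) : trunc a n m = 0 := if_neg hm.not_gt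

lemma walshFourier_dyadicPartialSum_eq (a : ℕ → ℂ) (n : ℕ) (t : ℝ) :
    walshFourier (dyadicPartialSum a n) t = trunc a n ⌊2 ^ 0 * t⌋₊ := by
  rw [walshFourier_dyadicPartialSum, pow_zero, one_mul, trunc]

lemma sum_norm_sq_cellValue (a : ℕ → ℂ) (n : ℕ) :
    ∑ p : Fin (2 ^ n), ‖cellValue a n p‖ ^ 2 = 2 ^ n * ∑ k : Fin (2 ^ n), ‖a k‖ ^ 2 := by
  rw [← Finset.sum_range fun p => ‖cellValue a n p‖ ^ 2, ← Finset.sum_range fun p => ‖a p‖ ^ 2,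
    ← sum_norm_sq_walshSign]
  refine Finset.sum_congr rfl fun p hp => ?_
  rw [cellValue, if_pos (Finset.mem_range.1 hp)]

lemma norm_sq_cellValue (a : ℕ → ℂ) (n : ℕ) (m : Fin (2 ^ n)) :
    ‖cellValue a n m‖ ^ 2 = 2 ^ n * ‖fastWalsh n (fun k => a k) m‖ ^ 2 := by
  have h : fastWalsh n (fun k => a k) m =
      (((2 : ℝ) ^ (-(n : ℝ) / 2) : ℝ) : ℂ) * cellValue a n m := by
    rw [cellValue, if_pos m.2, Finset.mul_sum, Finset.sum_range]
    simp only [fastWalsh, Matrix.vecMul, dotProduct, walshMatrix, Matrix.of_apply]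
    refine Finset.sum_congr rfl fun k _ => ?_
    have hx : ((k : ℕ) : ℝ) / 2 ^ n ∈ Ico (0 : ℝ) 1 := by
      refine ⟨by positivity, ?_⟩
      rw [div_lt_one (by positivity)]
      exact_mod_cast k.2
    rw [walsh_eq_walshSign (n := n) (by simp) hx, Nat.floor_natCast,
      mul_div_cancel₀ _ (by positivity), Nat.floor_natCast, walshSign_comm]
    push_cast
    ring
  have h2 : ((2 : ℝ) ^ (-(n : ℝ) / 2)) ^ 2 = 1 / 2 ^ n := by
    rw [← Real.rpow_natCast, ← Real.rpow_mul (by norm_num),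
      show -(n : ℝ) / 2 * (2 : ℕ) = -(n : ℝ) by push_cast; ring, Real.rpow_neg (by norm_num),
      Real.rpow_natCast, one_div]
  rw [h, norm_mul, mul_pow, Complex.norm_real, Real.norm_eq_abs, sq_abs, h2]
  field_simp

/-- The closed form of `V` of a partial sum. -/
lemma V_dyadicPartialSum (a : ℕ → ℂ) (n : ℕ) :
    V (dyadicPartialSum a n) = ENNReal.ofReal
      ((Finset.univ.inf' Finset.univ_nonempty fun k₀ : Fin (2 ^ n) =>
          ∑ k : Fin (2 ^ n), ‖fastWalsh n (fun k => a k) (k ^^^ k₀)‖ ^ 2 *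
            ((((k : ℕ) : ℝ) + 1) ^ 3 - ((k : ℕ) : ℝ) ^ 3) * (2 : ℝ) ^ (-2 * (n : ℤ)) / 3) /
        ∑ k : Fin (2 ^ n), ‖a k‖ ^ 2) := by
  rw [V_step (dyadicPartialSum_eq a n) fun m => cellValue_of_le, sum_norm_sq_cellValue]
  congr 2
  · congr 1
    funext l
    refine Finset.sum_congr rfl fun k _ => ?_
    rw [norm_sq_cellValue, moment, neg_mul, zpow_neg, zpow_mul, zpow_natCast,
      show (8 : ℝ) ^ n = 2 ^ n * ((2 : ℝ) ^ (2 : ℤ)) ^ n by rw [← mul_pow]; norm_num]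
    field_simp
  · field_simp

/-- The closed form of `V` of the Walsh–Fourier transform of a partial sum. -/
lemma V_walshFourier_dyadicPartialSum (a : ℕ → ℂ) (n : ℕ) :
    V (walshFourier (dyadicPartialSum a n)) = ENNReal.ofReal
      ((Finset.univ.inf' Finset.univ_nonempty fun k₁ : Fin (2 ^ n) =>
          ∑ k : Fin (2 ^ n), ‖a ((k ^^^ k₁ : Fin (2 ^ n)) : ℕ)‖ ^ 2 *
            ((((k : ℕ) : ℝ) + 1) ^ 3 - ((k : ℕ) : ℝ) ^ 3) / 3) /
        ∑ k : Fin (2 ^ n), ‖fastWalsh n (fun k => a k) k‖ ^ 2) := by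
  have ht : ∀ k : Fin (2 ^ n), trunc a n k = a k := fun k => if_pos k.2
  have hP : ∑ k : Fin (2 ^ n), ‖fastWalsh n (fun k => a k) k‖ ^ 2 =
      ∑ k : Fin (2 ^ n), ‖a k‖ ^ 2 := by
    have h := sum_norm_sq_cellValue a n
    simp only [norm_sq_cellValue, ← Finset.mul_sum] at h
    exact mul_left_cancel₀ (by positivity) h
  rw [V_step (fun t _ => walshFourier_dyadicPartialSum_eq a n t) fun m => trunc_of_le, hP]
  simp only [ht, pow_zero, div_one, one_mul, moment, mul_div_assoc]

/-! ### Convergence of the partial sums -/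

lemma setLIntegral_Ici_eq {f : ℝ → ℂ} (hf : ∀ x ∉ Ico (0 : ℝ) 1, f x = 0) (g : ℝ → ℝ≥0∞) :
    ∫⁻ x in Ici (0 : ℝ), g x * ‖f x‖ₑ ^ 2 = ∫⁻ x in Ico (0 : ℝ) 1, g x * ‖f x‖ₑ ^ 2 := by
  rw [← lintegral_indicator measurableSet_Ici, ← lintegral_indicator measurableSet_Ico]
  congr 1
  ext x
  by_cases h : x ∈ Ico (0 : ℝ) 1
  · rw [indicator_of_mem h, indicator_of_mem (Ico_subset_Ici_self h)]
  · rw [indicator_of_notMem h]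
    refine indicator_apply_eq_zero.2 fun _ => ?_
    rw [hf x h]
    simp

/-- For a function supported in `[0, 1)` the infimum in `V` may be taken over `[0, 1)`. -/
lemma iInf_eq_iInf_Ico {f : ℝ → ℂ} (hf : ∀ x ∉ Ico (0 : ℝ) 1, f x = 0) :
    ⨅ y ∈ Ici (0 : ℝ), ∫⁻ x in Ici (0 : ℝ), ENNReal.ofReal (dyadicAdd x y ^ 2) * ‖f x‖ₑ ^ 2 =
      ⨅ y : Ico (0 : ℝ) 1,
        ∫⁻ x in Ico (0 : ℝ) 1, ENNReal.ofReal (dyadicAdd x y ^ 2) * ‖f x‖ₑ ^ 2 := by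
  simp only [setLIntegral_Ici_eq hf]
  refine le_antisymm (le_iInf fun y => iInf₂_le (y : ℝ) y.2.1) (le_iInf₂ fun y hy => ?_)
  have hy' : y - ⌊y⌋₊ ∈ Ico (0 : ℝ) 1 :=
    ⟨sub_nonneg.2 (Nat.floor_le hy), by linarith [Nat.lt_floor_add_one y]⟩
  refine (iInf_le _ ⟨_, hy'⟩).trans (setLIntegral_mono' measurableSet_Ico fun x hx => ?_)
  gcongr
  · exact dyadicAdd_nonneg _ _
  · exact dyadicAdd_sub_floor_le hx hy

lemma setLIntegral_le_add {g : ℝ → ℝ≥0∞} (hg : Measurable g) (hg1 : ∀ x ∈ Ico (0 : ℝ) 1, g x ≤ 1)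
    {f h : ℝ → ℂ} {ε : ℝ≥0∞} (hfh : ∀ x ∈ Ico (0 : ℝ) 1, ‖f x‖ₑ ^ 2 ≤ ‖h x‖ₑ ^ 2 + ε) :
    ∫⁻ x in Ico (0 : ℝ) 1, g x * ‖f x‖ₑ ^ 2 ≤ (∫⁻ x in Ico (0 : ℝ) 1, g x * ‖h x‖ₑ ^ 2) + ε := by
  calc ∫⁻ x in Ico (0 : ℝ) 1, g x * ‖f x‖ₑ ^ 2
      ≤ ∫⁻ x in Ico (0 : ℝ) 1, (g x * ‖h x‖ₑ ^ 2 + g x * ε) :=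
        setLIntegral_mono' measurableSet_Ico fun x hx => by
          rw [← mul_add]
          gcongr
          exact hfh x hx
    _ = (∫⁻ x in Ico (0 : ℝ) 1, g x * ‖h x‖ₑ ^ 2) + ∫⁻ x in Ico (0 : ℝ) 1, g x * ε :=
        lintegral_add_right _ (hg.mul_const _)
    _ ≤ (∫⁻ x in Ico (0 : ℝ) 1, g x * ‖h x‖ₑ ^ 2) + ∫⁻ _ in Ico (0 : ℝ) 1, ε := by
        refine add_le_add ?_ ?_
        · exact le_rfl
        · exact setLIntegral_mono' measurableSet_Ico fun x hx => mul_le_of_le_one_left' (hg1 x hx)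
    _ = _ := by simp

lemma iInf_le_add {f h : ℝ → ℂ} (hf : ∀ x ∉ Ico (0 : ℝ) 1, f x = 0)
    (hh : ∀ x ∉ Ico (0 : ℝ) 1, h x = 0) {ε : ℝ≥0∞}
    (hfh : ∀ x ∈ Ico (0 : ℝ) 1, ‖f x‖ₑ ^ 2 ≤ ‖h x‖ₑ ^ 2 + ε) :
    ⨅ y ∈ Ici (0 : ℝ), ∫⁻ x in Ici (0 : ℝ), ENNReal.ofReal (dyadicAdd x y ^ 2) * ‖f x‖ₑ ^ 2 ≤
      (⨅ y ∈ Ici (0 : ℝ),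
        ∫⁻ x in Ici (0 : ℝ), ENNReal.ofReal (dyadicAdd x y ^ 2) * ‖h x‖ₑ ^ 2) + ε := by
  rw [iInf_eq_iInf_Ico hf, iInf_eq_iInf_Ico hh, ENNReal.iInf_add]
  refine iInf_mono fun y => setLIntegral_le_add ?_ (fun x hx => ?_) hfh
  · exact ((measurable_dyadicAdd y).pow_const 2).ennreal_ofReal
  · rw [← ENNReal.ofReal_one]
    exact ENNReal.ofReal_le_ofReal (pow_le_one₀ (dyadicAdd_nonneg _ _) (dyadicAdd_le_one hx y.2))

lemma lintegral_sq_le_add {f h : ℝ → ℂ} (hf : ∀ x ∉ Ico (0 : ℝ) 1, f x = 0)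
    (hh : ∀ x ∉ Ico (0 : ℝ) 1, h x = 0) {ε : ℝ≥0∞}
    (hfh : ∀ x ∈ Ico (0 : ℝ) 1, ‖f x‖ₑ ^ 2 ≤ ‖h x‖ₑ ^ 2 + ε) :
    ∫⁻ x in Ici (0 : ℝ), ‖f x‖ₑ ^ 2 ≤ (∫⁻ x in Ici (0 : ℝ), ‖h x‖ₑ ^ 2) + ε := by
  have h1 := setLIntegral_le_add (g := fun _ => 1) measurable_const (fun _ _ => le_rfl) hfh
  rw [← setLIntegral_Ici_eq hf, ← setLIntegral_Ici_eq hh] at h1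
  simpa only [one_mul] using h1

lemma dyadicPartialSum_eq_zero (a : ℕ → ℂ) (n : ℕ) :
    ∀ x ∉ Ico (0 : ℝ) 1, dyadicPartialSum a n x = 0 := fun _ hx => indicator_of_notMem hx _

lemma tendsto_two_pow : Tendsto (fun n : ℕ => 2 ^ n) atTop (atTop : Filter ℕ) :=
  tendsto_pow_atTop_atTop_of_one_lt one_lt_two

/-- The functions `|f_n|²` converge uniformly to `|f|²`. -/
lemma eventually_enorm_sq_le {a : ℕ → ℂ} {f : ℝ → ℂ}
    (hconv : TendstoUniformlyOn (walshSum a) f atTop (Ico (0 : ℝ) 1)) {ε : ℝ≥0∞} (hε : 0 < ε) :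
    ∀ᶠ n in atTop, ∀ x ∈ Ico (0 : ℝ) 1,
      ‖dyadicPartialSum a n x‖ₑ ^ 2 ≤ ‖f x‖ₑ ^ 2 + ε ∧
      ‖f x‖ₑ ^ 2 ≤ ‖dyadicPartialSum a n x‖ₑ ^ 2 + ε := by
  obtain ⟨C, hC0, hC⟩ := exists_bound hconv
  obtain ⟨r, hr0, hr⟩ := ENNReal.lt_iff_exists_nnreal_btwn.1 hε
  have hr0' : (0 : ℝ) < r := by exact_mod_cast hr0
  have key (u v : ℂ) (h : ‖u‖ ^ 2 ≤ ‖v‖ ^ 2 + r) : ‖u‖ₑ ^ 2 ≤ ‖v‖ₑ ^ 2 + ε := by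
    refine le_trans ?_ (add_le_add_right hr.le _)
    rw [← ofReal_norm, ← ofReal_norm, ← ENNReal.ofReal_pow (norm_nonneg _),
      ← ENNReal.ofReal_pow (norm_nonneg _), ← ENNReal.ofReal_coe_nnreal,
      ← ENNReal.ofReal_add (by positivity) hr0'.le]
    exact ENNReal.ofReal_le_ofReal h
  have hδ : 0 < min 1 ((r : ℝ) / (2 * C + 1)) := lt_min one_pos (by positivity)
  filter_upwards [tendsto_two_pow.eventually (Metric.tendstoUniformlyOn_iff.1 hconv _ hδ)]
    with n hn x hx
  have h := hn x hx
  have hle := hC x hx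
  rw [dist_eq_norm, lt_min_iff, lt_div_iff₀ (by positivity)] at h
  rw [dyadicPartialSum, indicator_of_mem hx]
  have h1 := abs_le.1 (abs_norm_sub_norm_le (f x) (walshSum a (2 ^ n) x))
  have h2 := norm_nonneg (f x)
  have h3 := norm_nonneg (walshSum a (2 ^ n) x)
  constructor <;> apply key <;> nlinarith

lemma tendsto_of_le_add {u : ℕ → ℝ≥0∞} {l : ℝ≥0∞}
    (h : ∀ ε > 0, ∀ᶠ n in atTop, u n ≤ l + ε ∧ l ≤ u n + ε) : Tendsto u atTop (𝓝 l) :=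
  ENNReal.tendsto_nhds_of_Icc fun ε hε => (h ε hε).mono fun _ hn =>
    ⟨tsub_le_iff_right.2 hn.2, hn.1⟩

lemma tendsto_iInf_dyadicPartialSum {a : ℕ → ℂ} {f : ℝ → ℂ}
    (hconv : TendstoUniformlyOn (walshSum a) f atTop (Ico (0 : ℝ) 1))
    (hsupp : ∀ x ∉ Ico (0 : ℝ) 1, f x = 0) :
    Tendsto (fun n => ⨅ y ∈ Ici (0 : ℝ), ∫⁻ x in Ici (0 : ℝ),
        ENNReal.ofReal (dyadicAdd x y ^ 2) * ‖dyadicPartialSum a n x‖ₑ ^ 2) atTop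
      (𝓝 (⨅ y ∈ Ici (0 : ℝ), ∫⁻ x in Ici (0 : ℝ),
        ENNReal.ofReal (dyadicAdd x y ^ 2) * ‖f x‖ₑ ^ 2)) :=
  tendsto_of_le_add fun _ hε => (eventually_enorm_sq_le hconv hε).mono fun n hn =>
    ⟨iInf_le_add (dyadicPartialSum_eq_zero a n) hsupp fun x hx => (hn x hx).1,
      iInf_le_add hsupp (dyadicPartialSum_eq_zero a n) fun x hx => (hn x hx).2⟩

lemma tendsto_lintegral_sq_dyadicPartialSum {a : ℕ → ℂ} {f : ℝ → ℂ}
    (hconv : TendstoUniformlyOn (walshSum a) f atTop (Ico (0 : ℝ) 1))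
    (hsupp : ∀ x ∉ Ico (0 : ℝ) 1, f x = 0) :
    Tendsto (fun n => ∫⁻ x in Ici (0 : ℝ), ‖dyadicPartialSum a n x‖ₑ ^ 2) atTop
      (𝓝 (∫⁻ x in Ici (0 : ℝ), ‖f x‖ₑ ^ 2)) :=
  tendsto_of_le_add fun _ hε => (eventually_enorm_sq_le hconv hε).mono fun n hn =>
    ⟨lintegral_sq_le_add (dyadicPartialSum_eq_zero a n) hsupp fun x hx => (hn x hx).1,
      lintegral_sq_le_add hsupp (dyadicPartialSum_eq_zero a n) fun x hx => (hn x hx).2⟩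

lemma lintegral_sq_lt_top {a : ℕ → ℂ} {f : ℝ → ℂ}
    (hconv : TendstoUniformlyOn (walshSum a) f atTop (Ico (0 : ℝ) 1))
    (hsupp : ∀ x ∉ Ico (0 : ℝ) 1, f x = 0) : ∫⁻ x in Ici (0 : ℝ), ‖f x‖ₑ ^ 2 < ⊤ := by
  obtain ⟨C, _, hC⟩ := exists_bound hconv
  have h := lintegral_sq_le_add (h := fun _ => 0) (ε := ENNReal.ofReal C ^ 2) hsupp
    (fun _ _ => rfl) fun x hx => by
      rw [← ofReal_norm]
      refine le_add_left ?_
      gcongr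
      exact hC x hx
  refine h.trans_lt ?_
  simp

/-! ### Convergence on the Fourier side -/

lemma tsum_trunc (a : ℕ → ℂ) (n : ℕ) (r : ℕ → ℝ≥0∞) :
    ∑' m, ‖trunc a n m‖ₑ ^ 2 * r m = ∑ m ∈ Finset.range (2 ^ n), ‖a m‖ₑ ^ 2 * r m := by
  rw [tsum_eq_sum (s := Finset.range (2 ^ n)) fun m hm => by
    rw [trunc_of_le (by simpa using hm)]; simp]
  exact Finset.sum_congr rfl fun m hm => by rw [trunc, if_pos (Finset.mem_range.1 hm)]

lemma tendsto_tsum_trunc (a : ℕ → ℂ) (r : ℕ → ℝ≥0∞) :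
    Tendsto (fun n => ∑' m, ‖trunc a n m‖ₑ ^ 2 * r m) atTop (𝓝 (∑' m, ‖a m‖ₑ ^ 2 * r m)) := by
  simp only [tsum_trunc]
  exact (ENNReal.tendsto_nat_tsum fun m => ‖a m‖ₑ ^ 2 * r m).comp tendsto_two_pow

lemma stepMoment_trunc_le (a : ℕ → ℂ) (n q : ℕ) : stepMoment (trunc a n) q ≤ stepMoment a q := by
  refine ENNReal.tsum_le_tsum fun m => ?_
  unfold trunc
  split_ifs <;> simp

lemma tendsto_moment_xor (j : ℕ) : Tendsto (fun q => moment (j ^^^ q)) atTop atTop := by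
  have h : ∀ q : ℕ, (q : ℝ) - 2 ^ j ≤ moment (j ^^^ q) := fun q => by
    have h1 : q ≤ 2 ^ j + (j ^^^ q) := by
      -- `j ^^^ q` and `q` agree in all digits beyond the first `j`.
      have h := Nat.xor_div_two_pow (a := j) (b := q) (n := j)
      rw [Nat.div_eq_of_lt Nat.lt_two_pow_self, Nat.zero_xor] at h
      have h4 := Nat.div_mul_le_self (j ^^^ q) (2 ^ j)
      have h5 := Nat.div_add_mod' q (2 ^ j)
      have h6 := Nat.mod_lt q (Nat.two_pow_pos j)
      rw [h] at h4
      omega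
    have h2 : ∀ k : ℕ, (k : ℝ) ≤ moment k := fun k => by
      unfold moment
      nlinarith [sq_nonneg (k : ℝ)]
    have h3 : (q : ℝ) ≤ 2 ^ j + (j ^^^ q : ℕ) := by exact_mod_cast h1
    linarith [h2 (j ^^^ q)]
  exact tendsto_atTop_mono h (tendsto_atTop_add_const_right _ (-(2 : ℝ) ^ j) tendsto_natCast_atTop_atTop)

/-- If `a j ≠ 0`, then the moments about `q` tend to infinity with `q`, uniformly in the truncation.
So only finitely many `q` matter for the infimum, and for each of them the moments converge
monotonically. -/
lemma tendsto_iInf_stepMoment {a : ℕ → ℂ} {j : ℕ} (hj : a j ≠ 0) :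
    Tendsto (fun n => ⨅ q, stepMoment (trunc a n) q) atTop (𝓝 (⨅ q, stepMoment a q)) := by
  refine tendsto_order.2 ⟨fun b hb => ?_, fun b hb => Eventually.of_forall fun n =>
    (iInf_mono (stepMoment_trunc_le a n)).trans_lt hb⟩
  obtain ⟨b', hbb', hb'⟩ := exists_between hb
  have htop : Tendsto (fun q => ‖a j‖ₑ ^ 2 * ENNReal.ofReal (moment (j ^^^ q))) atTop (𝓝 ⊤) := by
    have h := ENNReal.Tendsto.const_mul (a := ‖a j‖ₑ ^ 2)
      (ENNReal.tendsto_ofReal_nhds_top.2 (tendsto_moment_xor j)) (Or.inl ENNReal.top_ne_zero)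
    rwa [ENNReal.mul_top (by simpa using hj)] at h
  obtain ⟨K, hK⟩ := eventually_atTop.1 ((tendsto_order.1 htop).1 b' (hb'.trans_le le_top))
  have hfin : ∀ᶠ n in atTop, ∀ q ∈ Finset.range K, b' < stepMoment (trunc a n) q :=
    (eventually_all_finset _).2 fun q _ =>
      (tendsto_order.1 (tendsto_tsum_trunc a fun m => ENNReal.ofReal (moment (m ^^^ q)))).1 b'
        (hb'.trans_le (iInf_le _ q))
  filter_upwards [hfin, eventually_ge_atTop j] with n hn hjn
  refine hbb'.trans_le (le_iInf fun q => ?_)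
  rcases lt_or_ge q K with hq | hq
  · exact (hn q (Finset.mem_range.2 hq)).le
  · refine (hK q hq).le.trans ?_
    have hj' : trunc a n j = a j := if_pos (hjn.trans_lt Nat.lt_two_pow_self)
    rw [← hj']
    exact ENNReal.le_tsum (f := fun m => ‖trunc a n m‖ₑ ^ 2 * ENNReal.ofReal (moment (m ^^^ q))) j

/-- Parseval's identity for the partial sums. -/
lemma lintegral_sq_dyadicPartialSum (a : ℕ → ℂ) (n : ℕ) :
    ∫⁻ x in Ici (0 : ℝ), ‖dyadicPartialSum a n x‖ₑ ^ 2 = ∑' m, ‖trunc a n m‖ₑ ^ 2 := by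
  have h1 := tsum_eq_ofReal_sum (b := cellValue a n) (fun m => cellValue_of_le) (fun _ => 1)
    (fun _ => zero_le_one)
  have h2 := tsum_eq_ofReal_sum (b := trunc a n) (fun m => trunc_of_le) (fun _ => 1)
    (fun _ => zero_le_one)
  have ht : ∀ k : Fin (2 ^ n), trunc a n k = a k := fun k => if_pos k.2
  simp only [ENNReal.ofReal_one, mul_one, ht] at h1 h2
  rw [lintegral_sq_step (dyadicPartialSum_eq a n), h1, h2, ← ENNReal.ofReal_mul (by positivity),
    sum_norm_sq_cellValue]
  congr 1
  field_simp

/-- Parseval's identity for a uniformly convergent Walsh series. -/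
lemma lintegral_sq_eq_tsum {a : ℕ → ℂ} {f : ℝ → ℂ}
    (hconv : TendstoUniformlyOn (walshSum a) f atTop (Ico (0 : ℝ) 1))
    (hsupp : ∀ x ∉ Ico (0 : ℝ) 1, f x = 0) :
    ∫⁻ x in Ici (0 : ℝ), ‖f x‖ₑ ^ 2 = ∑' m, ‖a m‖ₑ ^ 2 := by
  have h := tendsto_lintegral_sq_dyadicPartialSum hconv hsupp
  simp only [lintegral_sq_dyadicPartialSum] at h
  exact tendsto_nhds_unique h (by simpa using tendsto_tsum_trunc a fun _ => 1)

/-- `V` of a step function on cells of length `1 = 2 ^ (-0)`, with possibly infinite support. -/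
lemma V_unit_step {b : ℕ → ℂ} {g : ℝ → ℂ} (hg : ∀ t, 0 ≤ t → g t = b ⌊2 ^ 0 * t⌋₊) :
    V g = (⨅ q, stepMoment b q) / ∑' m, ‖b m‖ₑ ^ 2 := by
  rw [V, iInf_lintegral_step hg, lintegral_sq_step hg]
  simp

/-- If the Walsh series is not identically zero, both factors of the uncertainty constants of its
partial sums converge. -/
lemma tendsto_V {a : ℕ → ℂ} {f : ℝ → ℂ}
    (hconv : TendstoUniformlyOn (walshSum a) f atTop (Ico (0 : ℝ) 1))
    (hsupp : ∀ x ∉ Ico (0 : ℝ) 1, f x = 0) {j : ℕ} (hj : a j ≠ 0) :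
    Tendsto (fun n => V (dyadicPartialSum a n)) atTop (𝓝 (V f)) ∧
    Tendsto (fun n => V (walshFourier (dyadicPartialSum a n))) atTop (𝓝 (V (walshFourier f))) := by
  have hD := lintegral_sq_eq_tsum hconv hsupp
  have hD0 : ∑' m, ‖a m‖ₑ ^ 2 ≠ 0 := fun h =>
    hj (by simpa using ENNReal.tsum_eq_zero.1 h j)
  have hDtop : ∑' m, ‖a m‖ₑ ^ 2 ≠ ⊤ := hD ▸ (lintegral_sq_lt_top hconv hsupp).ne
  constructor
  · refine ENNReal.Tendsto.div (tendsto_iInf_dyadicPartialSum hconv hsupp) (Or.inr ?_)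
      (tendsto_lintegral_sq_dyadicPartialSum hconv hsupp) (Or.inl ?_) <;> rwa [hD]
  · have hF : ∀ t, 0 ≤ t → walshFourier f t = a ⌊2 ^ 0 * t⌋₊ := fun t _ => by
      rw [walshFourier_eq_coeff hconv hsupp, pow_zero, one_mul]
    simp only [V_unit_step fun t _ => walshFourier_dyadicPartialSum_eq a _ t]
    rw [V_unit_step hF]
    exact ENNReal.Tendsto.div (tendsto_iInf_stepMoment hj) (Or.inr hD0)
      (by simpa using tendsto_tsum_trunc a fun _ => 1) (Or.inl hDtop)

end DyadicUC

theorem lemma1 (a : ℕ → ℂ) (f : ℝ → ℂ)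
    (hconv : TendstoUniformlyOn (DyadicUC.walshSum a) f atTop (Ico (0 : ℝ) 1))
    (hsupp : ∀ x ∉ Ico (0 : ℝ) 1, f x = 0)
    (hV : DyadicUC.V f < ⊤) (hV' : DyadicUC.V (DyadicUC.walshFourier f) < ⊤) :
    Tendsto (fun n : ℕ => DyadicUC.V (DyadicUC.dyadicPartialSum a n) *
        DyadicUC.V (DyadicUC.walshFourier (DyadicUC.dyadicPartialSum a n)))
      atTop (𝓝 (DyadicUC.UCd f)) ∧
    ∀ (n : ℕ) (c : Fin (2 ^ n) → ℂ), c = DyadicUC.fastWalsh n (fun k => a k) →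
      DyadicUC.V (DyadicUC.dyadicPartialSum a n) =
        ENNReal.ofReal
          ((Finset.univ.inf' Finset.univ_nonempty fun k₀ : Fin (2 ^ n) =>
              ∑ k : Fin (2 ^ n), ‖c (k ^^^ k₀)‖ ^ 2 *
                ((((k : ℕ) : ℝ) + 1) ^ 3 - ((k : ℕ) : ℝ) ^ 3) * (2 : ℝ) ^ (-2 * (n : ℤ)) / 3) /
            ∑ k : Fin (2 ^ n), ‖a k‖ ^ 2) ∧
      DyadicUC.V (DyadicUC.walshFourier (DyadicUC.dyadicPartialSum a n)) =
        ENNReal.ofReal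
          ((Finset.univ.inf' Finset.univ_nonempty fun k₁ : Fin (2 ^ n) =>
              ∑ k : Fin (2 ^ n), ‖a ((k ^^^ k₁ : Fin (2 ^ n)) : ℕ)‖ ^ 2 *
                ((((k : ℕ) : ℝ) + 1) ^ 3 - ((k : ℕ) : ℝ) ^ 3) / 3) /
            ∑ k : Fin (2 ^ n), ‖c k‖ ^ 2) := by
  refine ⟨?_, ?_⟩
  · by_cases ha : ∃ j, a j ≠ 0
    · obtain ⟨j, hj⟩ := ha
      obtain ⟨h1, h2⟩ := DyadicUC.tendsto_V hconv hsupp hj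
      exact ENNReal.Tendsto.mul h1 (Or.inr hV'.ne) h2 (Or.inr hV.ne)
    · -- All transforms vanish, so `V` of each of them is `0 / 0 = 0`.
      push Not at ha
      have hz : ∀ g : ℝ → ℂ, (∀ t, 0 ≤ t → g t = a ⌊2 ^ 0 * t⌋₊) → DyadicUC.V g = 0 := fun g hg => by
        rw [DyadicUC.V_unit_step hg]
        simp [DyadicUC.stepMoment, ha]
      rw [DyadicUC.UCd, hz (DyadicUC.walshFourier f) fun t _ => by
        rw [DyadicUC.walshFourier_eq_coeff hconv hsupp, pow_zero, one_mul], mul_zero]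
      refine tendsto_const_nhds.congr fun n => ?_
      rw [hz (DyadicUC.walshFourier (DyadicUC.dyadicPartialSum a n)) fun t _ => by
        rw [DyadicUC.walshFourier_dyadicPartialSum, ha, ha, ite_self], mul_zero]
  · rintro n c rfl
    exact ⟨DyadicUC.V_dyadicPartialSum a n, DyadicUC.V_walshFourier_dyadicPartialSum a n⟩
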